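/- Consider the control-affine system $\Sigma$: $\dot x = f(x)+Gu$, $y = h(x)+Ju$, with state $x\in\mathbb{R}^n$, input $u\in\mathbb{R}^m$ and output $y\in\mathbb{R}^p$, where $f:\mathbb{R}^n\to\mathbb{R}^n$ and $h:\mathbb{R}^n\to\mathbb{R}^p$ are continuous, $G\in\mathbb{R}^{n\times m}$ has full column rank $m$, and $J\in\mathbb{R}^{p\times m}$. Assume that $\Sigma$ is forward complete: for every input $u$ that is square integrable on each $[0,T]$, a trajectory on $[0,\infty)$ starts at every initial state, every trajectory on an interval $[0,T)$ extends to $[0,\infty)$, and the outputs are square integrable on each $[0,T]$. Let $\mathcal{E}_\Sigma=\{\bar x : f(\bar x)+Gu=0 \text{ for some } u\in\mathbb{R}^m\}$ be the set of assignable equilibrium points and, for $\bar x\in\mathcal{E}_\Sigma$, let $\bar u = -(G^{\sf T}G)^{-1}G^{\sf T}f(\bar x)$ and $\bar y = h(\bar x)+J\bar u$. Suppose that $Q=Q^{\sf T}\in\mathbb{R}^{p\times p}$ is negative definite, $S\in\mathbb{R}^{p\times m}$, $R=R^{\sf T}\in\mathbb{R}^{m\times m}$, that $V:\mathbb{R}^n\to\mathbb{R}_{\ge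 0}$ is continuously differentiable and strictly convex, and that there are an integer $k>0$, a matrix $W\in\mathbb{R}^{k\times m}$ and a function $\ell:\mathbb{R}^n\times\mathbb{R}^n\to\mathbb{R}^k$ such that, for all $x\in\mathbb{R}^n$ and $\bar x\in\mathcal{E}_\Sigma$, $$[\nabla V(x)-\nabla V(\bar x)]^{\sf T}[f(x)-f(\bar x)] = [h(x)-h(\bar x)]^{\sf T}Q[h(x)-h(\bar x)]-\|\ell(x,\bar x)\|_2^2,$$ $$\tfrac12[\nabla V(x)-\nabla V(\bar x)]^{\sf T}G = [h(x)-h(\bar x)]^{\sf T}(QJ+S)-\ell(x,\bar x)^{\sf T}W,$$ $$W^{\sf T}W = R+J^{\sf T}S+S^{\sf T}J+J^{\sf T}QJ.$$ Suppose also that $\Sigma$ is equilibrium-independent observable: for every $\bar x\in\mathcal{E}_\Sigma$, no trajectory of $\dot x=f(x)+G\bar u$ other than $x(t)=\bar x$ remains in $\{x : h(x)+J\bar u=\bar y\}$ for all $t\ge 0$. Then every $\bar x\in\mathcal{E}_\Sigma$ is a locally asymptotically stable equilibrium of $\dot x=f(x)+G\bar u$. If moreover $V$ is strongly convex, then every $\bar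 x\in\mathcal{E}_\Sigma$ is a globally asymptotically stable equilibrium of $\dot x=f(x)+G\bar u$. -/

import Mathlib

open MeasureTheory Filter Topology Set
open scoped Matrix Gradient

/-- Data of the control-affine system `ẋ = f(x) + G u`, `y = h(x) + J u` with state space `ℝⁿ`,
input space `ℝᵐ` and output space `ℝᵖ` (all with the Euclidean norm). -/
structure ControlAffineSystem (n m p : ℕ) where
  /-- drift vector field -/
  f : EuclideanSpace ℝ (Fin n) → EuclideanSpace ℝ (Fin n)
  /-- output map -/
  h : EuclideanSpace ℝ (Fin n) → EuclideanSpace ℝ (Fin p)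
  /-- constant input matrix -/
  G : Matrix (Fin n) (Fin m) ℝ
  /-- constant throughput matrix -/
  J : Matrix (Fin p) (Fin m) ℝ

/-- The extended space `L²ₑ[0,∞)`: signals that are square integrable on every `[0,T]`.
Only the values at times `t ≥ 0` matter. -/
def IsL2e {d : ℕ} (v : ℝ → EuclideanSpace ℝ (Fin d)) : Prop :=
  ∀ T : ℝ, 0 < T → MemLp v 2 (volume.restrict (Icc 0 T))

namespace ControlAffineSystem

variable {n m p : ℕ}

/-- The right-hand side `f(x) + G u`. -/
noncomputable def rhs (sys : ControlAffineSystem n m p) (x : EuclideanSpace ℝ (Fin n))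
    (u : EuclideanSpace ℝ (Fin m)) : EuclideanSpace ℝ (Fin n) :=
  sys.f x + WithLp.toLp 2 (sys.G *ᵥ u.ofLp)

/-- The output `h(x) + J u`. -/
noncomputable def output (sys : ControlAffineSystem n m p) (x : EuclideanSpace ℝ (Fin n))
    (u : EuclideanSpace ℝ (Fin m)) : EuclideanSpace ℝ (Fin p) :=
  sys.h x + WithLp.toLp 2 (sys.J *ᵥ u.ofLp)

/-- `x` is a (Carathéodory) trajectory of `ẋ = f(x) + G u` on the time set `I`, which is an
interval with left endpoint `0`, included. For continuous `f` and constant `u` this is the same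
as a classical solution of the differential equation. -/
def IsTrajectoryOn (sys : ControlAffineSystem n m p) (u : ℝ → EuclideanSpace ℝ (Fin m))
    (x : ℝ → EuclideanSpace ℝ (Fin n)) (I : Set ℝ) : Prop :=
  ContinuousOn x I ∧ ∀ t ∈ I, x t = x 0 + ∫ s in (0 : ℝ)..t, sys.rhs (x s) (u s)

/-- Forward completeness: for all inputs in `L²ₑ`, from every initial condition a trajectory on
`[0,∞)` starts, every trajectory on some `[0,T)` extends to `[0,∞)`, and the outputs are
in `L²ₑ`. -/
structure IsForwardComplete (sys : ControlAffineSystem n m p) : Prop where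
  exists_trajectory : ∀ u : ℝ → EuclideanSpace ℝ (Fin m), IsL2e u →
    ∀ x₀ : EuclideanSpace ℝ (Fin n),
      ∃ x : ℝ → EuclideanSpace ℝ (Fin n), sys.IsTrajectoryOn u x (Ici 0) ∧ x 0 = x₀
  extends_trajectory : ∀ u : ℝ → EuclideanSpace ℝ (Fin m), IsL2e u →
    ∀ (T : ℝ) (x : ℝ → EuclideanSpace ℝ (Fin n)), 0 < T → sys.IsTrajectoryOn u x (Ico 0 T) →
      ∃ z : ℝ → EuclideanSpace ℝ (Fin n),
        sys.IsTrajectoryOn u z (Ici 0) ∧ ∀ t ∈ Ico 0 T, z t = x t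
  output_isL2e : ∀ u : ℝ → EuclideanSpace ℝ (Fin m), IsL2e u →
    ∀ x : ℝ → EuclideanSpace ℝ (Fin n), sys.IsTrajectoryOn u x (Ici 0) →
      IsL2e (fun t => sys.output (x t) (u t))

/-- Standing assumptions on the system: continuous `f` and `h`, full column rank of `G`,
and forward completeness. -/
structure IsAdmissible (sys : ControlAffineSystem n m p) : Prop where
  continuous_f : Continuous sys.f
  continuous_h : Continuous sys.h
  rank_G : sys.G.rank = m
  forwardComplete : sys.IsForwardComplete

/-- The set of assignable equilibrium points: states that are an equilibrium for some constant
input. -/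
def assignableEquilibria (sys : ControlAffineSystem n m p) : Set (EuclideanSpace ℝ (Fin n)) :=
  {xe | ∃ u : EuclideanSpace ℝ (Fin m), sys.rhs xe u = 0}

/-- The equilibrium input `k_u(x̄) = -(GᵀG)⁻¹ Gᵀ f(x̄)`. -/
noncomputable def eqInput (sys : ControlAffineSystem n m p) (xe : EuclideanSpace ℝ (Fin n)) :
    EuclideanSpace ℝ (Fin m) :=
  WithLp.toLp 2 (-(((sys.Gᵀ * sys.G)⁻¹ * sys.Gᵀ) *ᵥ (sys.f xe).ofLp))

/-- The equilibrium output `k_y(x̄) = h(x̄) + J k_u(x̄)`. -/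
noncomputable def eqOutput (sys : ControlAffineSystem n m p) (xe : EuclideanSpace ℝ (Fin n)) :
    EuclideanSpace ℝ (Fin p) :=
  sys.output xe (sys.eqInput xe)

/-- The Hill–Moylan conditions for equilibrium-independent dissipativity with the quadratic
supply rate `w(u,y) = yᵀQy + 2 yᵀSu + uᵀRu` and the convex function `V`. -/
structure SatisfiesEIDHillMoylan (sys : ControlAffineSystem n m p)
    (Q : Matrix (Fin p) (Fin p) ℝ) (S : Matrix (Fin p) (Fin m) ℝ) (R : Matrix (Fin m) (Fin m) ℝ)
    (V : EuclideanSpace ℝ (Fin n) → ℝ) : Prop where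
  symm_Q : Q.IsSymm
  symm_R : R.IsSymm
  nonneg : ∀ x, 0 ≤ V x
  contDiff : ContDiff ℝ 1 V
  convex : ConvexOn ℝ univ V
  conditions : ∃ k : ℕ, 0 < k ∧ ∃ (W : Matrix (Fin k) (Fin m) ℝ)
    (l : EuclideanSpace ℝ (Fin n) → EuclideanSpace ℝ (Fin n) → EuclideanSpace ℝ (Fin k)),
      (∀ x, ∀ xe ∈ sys.assignableEquilibria,
        inner ℝ (∇ V x - ∇ V xe) (sys.f x - sys.f xe)
            = (sys.h x - sys.h xe).ofLp ⬝ᵥ (Q *ᵥ (sys.h x - sys.h xe).ofLp) - ‖l x xe‖ ^ 2 ∧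
        (1 / 2 : ℝ) • ((∇ V x - ∇ V xe).ofLp ᵥ* sys.G)
            = (sys.h x - sys.h xe).ofLp ᵥ* (Q * sys.J + S) - (l x xe).ofLp ᵥ* W) ∧
      Wᵀ * W = R + sys.Jᵀ * S + Sᵀ * sys.J + sys.Jᵀ * Q * sys.J

/-- Equilibrium-independent observability: for every assignable equilibrium `x̄`, the only
trajectory of `ẋ = f(x) + G ū` that remains for all `t ≥ 0` in `{x | h(x) + J ū = ȳ}` is
`x(t) = x̄`. -/
def IsEIObservable (sys : ControlAffineSystem n m p) : Prop :=
  ∀ xe ∈ sys.assignableEquilibria, ∀ x : ℝ → EuclideanSpace ℝ (Fin n),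
    sys.IsTrajectoryOn (fun _ => sys.eqInput xe) x (Ici 0) →
    (∀ t, 0 ≤ t → sys.output (x t) (sys.eqInput xe) = sys.eqOutput xe) →
    ∀ t, 0 ≤ t → x t = xe

/-- `xe` is a (Lyapunov) stable equilibrium of `ẋ = f(x) + G ū` with constant input `ū`. -/
structure IsStableEquilibrium (sys : ControlAffineSystem n m p)
    (ue : EuclideanSpace ℝ (Fin m)) (xe : EuclideanSpace ℝ (Fin n)) : Prop where
  equilibrium : sys.rhs xe ue = 0
  stable : ∀ ε : ℝ, 0 < ε → ∃ δ : ℝ, 0 < δ ∧ ∀ x : ℝ → EuclideanSpace ℝ (Fin n),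
    sys.IsTrajectoryOn (fun _ => ue) x (Ici 0) → ‖x 0 - xe‖ < δ → ∀ t, 0 ≤ t → ‖x t - xe‖ < ε

/-- `xe` is a locally asymptotically stable equilibrium of `ẋ = f(x) + G ū`. -/
structure IsLocallyAsymptoticallyStable (sys : ControlAffineSystem n m p)
    (ue : EuclideanSpace ℝ (Fin m)) (xe : EuclideanSpace ℝ (Fin n)) : Prop
    extends sys.IsStableEquilibrium ue xe where
  attractive : ∃ r : ℝ, 0 < r ∧ ∀ x : ℝ → EuclideanSpace ℝ (Fin n),
    sys.IsTrajectoryOn (fun _ => ue) x (Ici 0) → ‖x 0 - xe‖ < r → Tendsto x atTop (𝓝 xe)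

/-- `xe` is a globally asymptotically stable equilibrium of `ẋ = f(x) + G ū`. -/
structure IsGloballyAsymptoticallyStable (sys : ControlAffineSystem n m p)
    (ue : EuclideanSpace ℝ (Fin m)) (xe : EuclideanSpace ℝ (Fin n)) : Prop
    extends sys.IsStableEquilibrium ue xe where
  attractive : ∀ x : ℝ → EuclideanSpace ℝ (Fin n),
    sys.IsTrajectoryOn (fun _ => ue) x (Ici 0) → Tendsto x atTop (𝓝 xe)

end ControlAffineSystem

/-! ### Limits of time shifts of integral curves. -/

section IntegralCurve

variable {E : Type*} [NormedAddCommGroup E] [NormedSpace ℝ E] {F : E → E} {x : ℝ → E}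

/-! With the input frozen at its equilibrium value the vector field is `f x - f xe`, so the Bregman
divergence of `V` at `xe` has derivative equal to the left side of the first Hill–Moylan identity;
this is at most a negative definite form in `h x - h xe`. Strict convexity makes the divergence
positive away from `xe` and at least linear far out (`exists_pos_mul_norm_le_bregman`), which gives
stability and bounded trajectories. Attraction is LaSalle's argument. The divergence converges along
a trajectory, and every limit point starts a trajectory on which it is constant
(`exists_integralCurve_of_mapClusterPt`). There `h x = h xe`, so observability leaves only `xe`.
This attraction is global; the local claim follows from it. -/

lemma continuous_comp_max_zero {X : Type*} [TopologicalSpace X] {x : ℝ → X}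
    (hx : ContinuousOn x (Ici 0)) :
    Continuous fun t : ℝ => x (max t 0) :=
  hx.comp_continuous (by fun_prop) fun t => le_max_right t 0

lemma intervalIntegral_comp_max_zero {g : ℝ → E} {t : ℝ} (ht : 0 ≤ t) :
    ∫ s in (0 : ℝ)..t, g (max s 0) = ∫ s in (0 : ℝ)..t, g s := by
  refine intervalIntegral.integral_congr fun s hs => ?_
  rw [uIcc_of_le ht] at hs
  simp [max_eq_left hs.1]

lemma hasDerivWithinAt_of_eq_add_integral [CompleteSpace E] (hF : Continuous F)
    (hx : ContinuousOn x (Ici 0))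
    (h : ∀ t ∈ Ici (0 : ℝ), x t = x 0 + ∫ s in (0 : ℝ)..t, F (x s)) {t : ℝ} (ht : 0 ≤ t) :
    HasDerivWithinAt x (F (x t)) (Ici 0) t := by
  have hc : Continuous fun s : ℝ => F (x (max s 0)) := hF.comp (continuous_comp_max_zero hx)
  have hd : HasDerivAt (fun t => x 0 + ∫ s in (0 : ℝ)..t, F (x (max s 0))) (F (x t)) t := by
    have := (hc.integral_hasStrictDerivAt 0 t).hasDerivAt.const_add (x 0)
    simpa [max_eq_left ht] using this
  have he : ∀ s ∈ Ici (0 : ℝ), x s = x 0 + ∫ r in (0 : ℝ)..s, F (x (max r 0)) := fun s hs => by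
    rw [intervalIntegral_comp_max_zero (g := fun r => F (x r)) hs, ← h s hs]
  exact hd.hasDerivWithinAt.congr he (he t ht)

/-- Uniform convergence of continuous functions along an arbitrary filter, not necessarily
countably generated, implies convergence of their integrals. -/
lemma TendstoUniformlyOn.tendsto_intervalIntegral_of_continuous {ι : Type*} {l : Filter ι}
    {g : ι → ℝ → E} {g₀ : ℝ → E} {a b : ℝ} (hg : ∀ i, Continuous (g i)) (hg₀ : Continuous g₀)
    (hlim : TendstoUniformlyOn g g₀ l (uIcc a b)) :
    Tendsto (fun i => ∫ s in a..b, g i s) l (𝓝 (∫ s in a..b, g₀ s)) := by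
  rw [Metric.tendsto_nhds]
  intro ε hε
  have hpos : 0 < |b - a| + 1 := by positivity
  filter_upwards [Metric.tendstoUniformlyOn_iff.1 hlim (ε / (|b - a| + 1)) (by positivity)]
    with i hi
  rw [dist_eq_norm, ← intervalIntegral.integral_sub ((hg i).intervalIntegrable a b)
    (hg₀.intervalIntegrable a b)]
  calc ‖∫ s in a..b, (g i s - g₀ s)‖ ≤ ε / (|b - a| + 1) * |b - a| := by
        refine intervalIntegral.norm_integral_le_of_norm_le_const fun s hs => ?_
        rw [← dist_eq_norm, dist_comm]
        exact (hi s (uIoc_subset_uIcc hs)).le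
    _ < ε := by
        rw [div_mul_eq_mul_div, div_lt_iff₀ hpos]
        nlinarith

/-- Every limit point of a bounded integral curve is the initial point of an integral curve
along which any function converging along the original curve is constant. The vector field is only
assumed to be continuous, so that integral curves need not be unique. -/
theorem exists_integralCurve_of_mapClusterPt [ProperSpace E] (hF : Continuous F)
    (hx : ContinuousOn x (Ici 0))
    (h : ∀ t ∈ Ici (0 : ℝ), x t = x 0 + ∫ s in (0 : ℝ)..t, F (x s))
    {K : Set E} (hK : IsCompact K) (hxK : ∀ t, 0 ≤ t → x t ∈ K)
    {Φ : E → ℝ} (hΦ : Continuous Φ) {L : ℝ} (hL : Tendsto (fun t => Φ (x t)) atTop (𝓝 L))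
    {z : E} (hz : MapClusterPt z atTop x) :
    ∃ y : ℝ → E, Continuous y ∧ (∀ t ∈ Ici (0 : ℝ), y t = y 0 + ∫ s in (0 : ℝ)..t, F (y s)) ∧
      y 0 = z ∧ ∀ t, 0 ≤ t → Φ (y t) = L := by
  -- Along an ultrafilter all shifts converge pointwise at once by compactness, so no subsequences
  -- need extracting.
  obtain ⟨U, hU, hUz⟩ := mapClusterPt_iff_ultrafilter.1 hz
  set X : ℝ → E := fun t => x (max t 0) with hX
  have hXx : ∀ t, 0 ≤ t → X t = x t := fun t ht => by simp [hX, max_eq_left ht]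
  have hXK : ∀ t, X t ∈ K := fun t => hxK _ (le_max_right t 0)
  obtain ⟨C, hC⟩ := hK.exists_bound_of_continuousOn hF.continuousOn
  have hlip : LipschitzOnWith C.toNNReal x (Ici 0) :=
    (convex_Ici 0).lipschitzOnWith_of_nnnorm_hasDerivWithin_le
      (fun t ht => hasDerivWithinAt_of_eq_add_integral hF hx h ht)
      fun t ht => NNReal.coe_le_coe.1 <| by
        simpa using Or.inl (hC _ (hxK t ht))
  have hXu : UniformContinuous X := by
    have hm : LipschitzWith 1 fun t : ℝ => max t 0 := LipschitzWith.id.max_const 0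
    refine uniformContinuousOn_univ.1 (UniformContinuousOn.comp (t := Ici 0)
      hlip.uniformContinuousOn hm.uniformContinuous.uniformContinuousOn ?_)
    exact fun t _ => le_max_right t 0
  have hgu : UniformContinuous fun t => F (X t) :=
    uniformContinuousOn_univ.1 ((hK.uniformContinuousOn_of_continuous hF.continuousOn).comp
      hXu.uniformContinuousOn fun t _ => hXK t)
  -- All shifts of a uniformly continuous function share its modulus of continuity.
  have hshift : ∀ g : ℝ → E, UniformContinuous g → UniformEquicontinuous fun (t s : ℝ) => g (t + s) := by
    intro g hg
    rw [Metric.uniformEquicontinuous_iff]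
    intro ε hε
    obtain ⟨δ, hδ, H⟩ := Metric.uniformContinuous_iff.1 hg ε hε
    exact ⟨δ, hδ, fun s s' hs t => H (by simpa using hs)⟩
  have hlim : ∀ s : ℝ, ∃ y, Tendsto (fun t => X (t + s)) U (𝓝 y) := fun s => by
    obtain ⟨y, -, hy⟩ := hK.ultrafilter_le_nhds (U.map fun t => X (t + s))
      (le_principal_iff.2 (Filter.mem_map.2 (Filter.univ_mem' fun t => hXK (t + s))))
    exact ⟨y, hy⟩
  choose y hy using hlim
  have hyc : Continuous y :=
    (tendsto_pi_nhds.2 hy).continuous_of_equicontinuous (hshift X hXu).equicontinuous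
  have hUpos : ∀ᶠ t in (U : Filter ℝ), 0 ≤ t := hU (eventually_ge_atTop 0)
  have hy0 : y 0 = z := by
    refine tendsto_nhds_unique (hy 0) (hUz.congr' ?_)
    filter_upwards [hUpos] with t ht
    simp [hXx t ht]
  refine ⟨y, hyc, fun t ht => ?_, hy0, fun t ht => ?_⟩
  · have hF' : Tendsto (fun t s => F (X (t + s))) U (𝓝 fun s => F (y s)) :=
      tendsto_pi_nhds.2 fun s => (hF.tendsto _).comp (hy s)
    -- Equicontinuity upgrades pointwise to locally uniform convergence, so the limit passes under
    -- the integral.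
    have hunif := (EquicontinuousOn.tendsto_uniformOnFun_iff_pi (𝔖 := {K : Set ℝ | IsCompact K})
      (fun K hK => hK) (sUnion_eq_univ_iff.2 fun s => ⟨{s}, isCompact_singleton, rfl⟩)
      (fun K _ => (hshift _ hgu).equicontinuous.equicontinuousOn K) U _).2 hF'
    have hint : Tendsto (fun τ => ∫ s in (0 : ℝ)..t, F (X (τ + s))) U
        (𝓝 (∫ s in (0 : ℝ)..t, F (y s))) :=
      TendstoUniformlyOn.tendsto_intervalIntegral_of_continuous
        (fun τ => hgu.continuous.comp (continuous_const.add continuous_id)) (hF.comp hyc)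
        ((UniformOnFun.tendsto_iff_tendstoUniformlyOn.1 hunif) (uIcc 0 t) isCompact_uIcc)
    refine tendsto_nhds_unique (hy t) (((hy 0).add hint).congr' ?_)
    filter_upwards [hUpos] with τ hτ
    have hi : ∀ a b, IntervalIntegrable (fun s => F (X s)) volume a b :=
      fun a b => hgu.continuous.intervalIntegrable a b
    have hXi : ∀ t, 0 ≤ t → X t = x 0 + ∫ s in (0 : ℝ)..t, F (X s) := fun t ht => by
      rw [hXx t ht, h t ht, intervalIntegral_comp_max_zero (g := fun r => F (x r)) ht]
    have ht' : (0 : ℝ) ≤ t := ht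
    have e : ∫ s in (0 : ℝ)..t, F (X (τ + s)) = ∫ s in τ..(τ + t), F (X s) := by
      simpa using intervalIntegral.integral_comp_add_left (a := 0) (b := t) (fun s => F (X s)) τ
    rw [e, add_zero, hXi τ hτ, hXi (τ + t) (by positivity), add_assoc,
      intervalIntegral.integral_add_adjacent_intervals (hi _ _) (hi _ _)]
  · refine tendsto_nhds_unique ((hΦ.tendsto _).comp (hy t)) ?_
    have : Tendsto (fun τ => Φ (x (τ + t))) U (𝓝 L) :=
      hL.comp ((tendsto_atTop_add_const_right _ t tendsto_id).mono_left hU)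
    refine this.congr' ?_
    filter_upwards [hUpos] with τ hτ
    simp [hXx (τ + t) (by positivity)]

end IntegralCurve

/-! ### Bregman divergence as a Lyapunov function. -/

section Bregman

variable {E : Type*} [NormedAddCommGroup E] [InnerProductSpace ℝ E] [CompleteSpace E]
  {V : E → ℝ} {a x : E}

/-- The Bregman divergence of `V` with base point `a`. -/
noncomputable def bregman (V : E → ℝ) (a x : E) : ℝ :=
  V x - V a - inner ℝ (∇ V a) (x - a)

@[simp] lemma bregman_self (V : E → ℝ) (a : E) : bregman V a a = 0 := by simp [bregman]

lemma continuous_bregman (hV : Continuous V) (a : E) : Continuous (bregman V a) := by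
  unfold bregman; fun_prop

/-- On the line from `a` to `x`, the slope of a strictly convex function over `[0, 1]` exceeds its
derivative at `0`. -/
lemma bregman_pos (hV : StrictConvexOn ℝ univ V) (hd : DifferentiableAt ℝ V a) (hx : x ≠ a) :
    0 < bregman V a x := by
  have hline : StrictConvexOn ℝ univ fun t : ℝ => V (AffineMap.lineMap a x t) := by
    refine ⟨convex_univ, fun s _ t _ hst p q hp hq hpq => ?_⟩
    have := hV.2 (mem_univ (AffineMap.lineMap a x s)) (mem_univ (AffineMap.lineMap a x t))
      (fun e => hst (AffineMap.lineMap_injective ℝ hx.symm e)) hp hq hpq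
    rwa [← Convex.combo_affine_apply hpq] at this
  have hder : HasDerivAt (fun t : ℝ => V (AffineMap.lineMap a x t)) (inner ℝ (∇ V a) (x - a)) 0 := by
    have h0 : HasFDerivAt V (InnerProductSpace.toDual ℝ E (∇ V a))
        (AffineMap.lineMap a x (0 : ℝ)) := by
      simpa using hd.hasGradientAt.hasFDerivAt
    simpa [Function.comp_def] using h0.comp_hasDerivAt (0 : ℝ) AffineMap.hasDerivAt_lineMap
  have := hline.lt_slope_of_hasDerivAt (mem_univ 0) (mem_univ 1) zero_lt_one hder
  simp only [slope_def_field, AffineMap.lineMap_apply_one, AffineMap.lineMap_apply_zero] at this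
  unfold bregman
  linarith

lemma bregman_nonneg (hV : StrictConvexOn ℝ univ V) (hd : DifferentiableAt ℝ V a) (x : E) :
    0 ≤ bregman V a x := by
  rcases eq_or_ne x a with rfl | hx
  · simp
  · exact (bregman_pos hV hd hx).le

/-- The divergence is convex in its second argument and vanishes at `a`. -/
lemma bregman_lineMap_le (hV : ConvexOn ℝ univ V) (a x : E) {s : ℝ} (h0 : 0 ≤ s) (h1 : s ≤ 1) :
    bregman V a (AffineMap.lineMap a x s) ≤ s * bregman V a x := by
  have := hV.2 (mem_univ a) (mem_univ x) (sub_nonneg.2 h1) h0 (sub_add_cancel 1 s)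
  rw [← AffineMap.lineMap_apply_module] at this
  simp only [bregman, smul_eq_mul] at this ⊢
  rw [show AffineMap.lineMap a x s - a = s • (x - a) by simp [AffineMap.lineMap_apply],
    inner_smul_right]
  linarith

/-- The Bregman divergence of a strictly convex function grows at least linearly away from its
base point. -/
lemma exists_pos_mul_norm_le_bregman [ProperSpace E] (hV : StrictConvexOn ℝ univ V)
    (hd : Differentiable ℝ V) (a : E) {ε : ℝ} (hε : 0 < ε) :
    ∃ c : ℝ, 0 < c ∧ ∀ x, ε ≤ ‖x - a‖ → c * ‖x - a‖ ≤ bregman V a x := by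
  -- The sphere is empty only in the trivial space: any `x` at distance at least `ε` could be scaled
  -- onto it.
  rcases (Metric.sphere a ε).eq_empty_or_nonempty with he | hne
  · refine ⟨1, one_pos, fun x hx => ?_⟩
    have hr : 0 < ‖x - a‖ := hε.trans_le hx
    have : AffineMap.lineMap a x (ε / ‖x - a‖) ∈ Metric.sphere a ε := by
      simp [AffineMap.lineMap_apply, norm_smul, abs_of_pos hε, hr.ne']
    simp [he] at this
  · obtain ⟨w, hw, hmin⟩ := (isCompact_sphere a ε).exists_isMinOn hne
      (continuous_bregman hd.continuous a).continuousOn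
    have hwa : w ≠ a := by
      rintro rfl
      simp [hε.ne] at hw
    -- The slope is the minimum over the sphere divided by its radius.
    refine ⟨bregman V a w / ε, div_pos (bregman_pos hV (hd a) hwa) hε, fun x hx => ?_⟩
    have hr : 0 < ‖x - a‖ := hε.trans_le hx
    have hm : AffineMap.lineMap a x (ε / ‖x - a‖) ∈ Metric.sphere a ε := by
      simp [AffineMap.lineMap_apply, norm_smul, abs_of_pos hε, hr.ne']
    have h1 : bregman V a w ≤ bregman V a (AffineMap.lineMap a x (ε / ‖x - a‖)) := hmin hm
    have h2 := bregman_lineMap_le hV.convexOn a x (div_nonneg hε.le hr.le) ((div_le_one hr).2 hx)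
    have h3 := h1.trans h2
    rw [div_mul_eq_mul_div, le_div_iff₀ hr] at h3
    rw [div_mul_eq_mul_div, div_le_iff₀ hε]
    linarith

lemma hasDerivWithinAt_bregman_comp {s : Set ℝ} {γ : ℝ → E} {γ' : E} {t : ℝ}
    (hγ : HasDerivWithinAt γ γ' s t) (hd : DifferentiableAt ℝ V (γ t)) (a : E) :
    HasDerivWithinAt (fun t => bregman V a (γ t)) (inner ℝ (∇ V (γ t) - ∇ V a) γ') s t := by
  have h1 : HasDerivWithinAt (fun t => V (γ t)) (inner ℝ (∇ V (γ t)) γ') s t := by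
    simpa [Function.comp_def] using hd.hasGradientAt.hasFDerivAt.comp_hasDerivWithinAt t hγ
  have h2 : HasDerivWithinAt (fun t => inner ℝ (∇ V a) (γ t - a)) (inner ℝ (∇ V a) γ') s t := by
    simpa [Function.comp_def] using (innerSL ℝ (∇ V a)).hasFDerivAt.comp_hasDerivWithinAt t (hγ.sub_const a)
  rw [inner_sub_left]
  exact (h1.sub_const (V a)).sub h2

end Bregman

/-! ### Dissipation, stability and LaSalle's argument for the system. -/

namespace ControlAffineSystem

variable {n m p : ℕ} {sys : ControlAffineSystem n m p}
  {Q : Matrix (Fin p) (Fin p) ℝ} {S : Matrix (Fin p) (Fin m) ℝ} {R : Matrix (Fin m) (Fin m) ℝ}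
  {V : EuclideanSpace ℝ (Fin n) → ℝ} {xe : EuclideanSpace ℝ (Fin n)}
  {x : ℝ → EuclideanSpace ℝ (Fin n)}

lemma isUnit_det_transpose_mul_self (hG : sys.G.rank = m) : IsUnit (sys.Gᵀ * sys.G).det := by
  have h : (sys.Gᵀ * sys.G).rank = m := by rw [Matrix.rank_transpose_mul_self, hG]
  rw [← Matrix.isUnit_iff_isUnit_det, ← Matrix.mulVec_surjective_iff_isUnit]
  have ht : LinearMap.range (sys.Gᵀ * sys.G).mulVecLin = ⊤ :=
    Submodule.eq_top_of_finrank_eq (by simpa [Matrix.rank] using h)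
  exact LinearMap.range_eq_top.1 ht

/-- Full column rank makes `(GᵀG)⁻¹Gᵀ` a left inverse of `G`, so any equilibrium input `u` equals
`eqInput`. -/
lemma rhs_eqInput (hG : sys.G.rank = m) (hxe : xe ∈ sys.assignableEquilibria) :
    sys.rhs xe (sys.eqInput xe) = 0 := by
  obtain ⟨u, hu⟩ := hxe
  have hf : (sys.f xe).ofLp = -(sys.G *ᵥ u.ofLp) := by
    have := congrArg WithLp.ofLp hu
    simpa [rhs] using eq_neg_of_add_eq_zero_left this
  have : sys.eqInput xe = u := by
    ext1
    have hu' := isUnit_det_transpose_mul_self hG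
    simp [eqInput, hf, Matrix.mulVec_neg, Matrix.mulVec_mulVec, Matrix.mul_assoc,
      Matrix.nonsing_inv_mul _ hu']
  rw [this, hu]

lemma continuous_rhs (hf : Continuous sys.f) (u : EuclideanSpace ℝ (Fin m)) :
    Continuous fun x => sys.rhs x u :=
  hf.add continuous_const

lemma rhs_eqInput_eq_sub (hG : sys.G.rank = m) (hxe : xe ∈ sys.assignableEquilibria)
    (z : EuclideanSpace ℝ (Fin n)) :
    sys.rhs z (sys.eqInput xe) = sys.f z - sys.f xe := by
  have h := rhs_eqInput hG hxe
  simp only [rhs] at h ⊢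
  rw [eq_neg_of_add_eq_zero_right h, sub_eq_add_neg]

lemma dotProduct_mulVec_nonpos (hQ : (-Q).PosDef) (v : Fin p → ℝ) : v ⬝ᵥ (Q *ᵥ v) ≤ 0 := by
  have := hQ.posSemidef.dotProduct_mulVec_nonneg v
  simpa [Matrix.neg_mulVec] using this

lemma eq_zero_of_dotProduct_mulVec_nonneg (hQ : (-Q).PosDef) {v : Fin p → ℝ}
    (hv : 0 ≤ v ⬝ᵥ (Q *ᵥ v)) : v = 0 := by
  by_contra h
  have := hQ.dotProduct_mulVec_pos h
  simp [Matrix.neg_mulVec] at this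
  linarith

namespace SatisfiesEIDHillMoylan

lemma inner_gradient_sub_rhs_le (hHM : sys.SatisfiesEIDHillMoylan Q S R V)
    (hG : sys.G.rank = m) (hxe : xe ∈ sys.assignableEquilibria) (z : EuclideanSpace ℝ (Fin n)) :
    inner ℝ (∇ V z - ∇ V xe) (sys.rhs z (sys.eqInput xe)) ≤
      (sys.h z - sys.h xe).ofLp ⬝ᵥ (Q *ᵥ (sys.h z - sys.h xe).ofLp) := by
  obtain ⟨k, -, W, l, hl, -⟩ := hHM.conditions
  rw [rhs_eqInput_eq_sub hG hxe, (hl z xe hxe).1]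
  exact sub_le_self _ (sq_nonneg _)

end SatisfiesEIDHillMoylan

lemma IsTrajectoryOn.hasDerivWithinAt_bregman (hf : Continuous sys.f)
    (hV : Differentiable ℝ V) {u : EuclideanSpace ℝ (Fin m)}
    (hx : sys.IsTrajectoryOn (fun _ => u) x (Ici 0)) (a : EuclideanSpace ℝ (Fin n)) {t : ℝ}
    (ht : 0 ≤ t) :
    HasDerivWithinAt (fun t => bregman V a (x t)) (inner ℝ (∇ V (x t) - ∇ V a) (sys.rhs (x t) u))
      (Ici 0) t :=
  hasDerivWithinAt_bregman_comp
    (hasDerivWithinAt_of_eq_add_integral (continuous_rhs hf u) hx.1 hx.2 ht) (hV _) a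

lemma SatisfiesEIDHillMoylan.differentiable (hHM : sys.SatisfiesEIDHillMoylan Q S R V) :
    Differentiable ℝ V :=
  hHM.contDiff.differentiable one_ne_zero

/-- The Bregman divergence of the storage function is a Lyapunov function. -/
lemma IsTrajectoryOn.antitoneOn_bregman (hf : Continuous sys.f) (hG : sys.G.rank = m)
    (hHM : sys.SatisfiesEIDHillMoylan Q S R V) (hQ : (-Q).PosDef)
    (hxe : xe ∈ sys.assignableEquilibria)
    (hx : sys.IsTrajectoryOn (fun _ => sys.eqInput xe) x (Ici 0)) :
    AntitoneOn (fun t => bregman V xe (x t)) (Ici 0) := by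
  have hd := fun t (ht : (0 : ℝ) ≤ t) =>
    hx.hasDerivWithinAt_bregman hf hHM.differentiable xe ht
  refine antitoneOn_of_hasDerivWithinAt_nonpos (convex_Ici 0)
    (fun t ht => (hd t ht).continuousWithinAt)
    (fun t ht => (hd t (interior_subset ht)).mono interior_subset) fun t _ => ?_
  exact (hHM.inner_gradient_sub_rhs_le hG hxe _).trans (dotProduct_mulVec_nonpos hQ _)

/-- A zero derivative forces the form in `h x - h xe` to be nonnegative, hence `h x = h xe` by
definiteness, and observability applies. -/
lemma IsTrajectoryOn.eq_of_bregman_const (hf : Continuous sys.f) (hG : sys.G.rank = m)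
    (hHM : sys.SatisfiesEIDHillMoylan Q S R V) (hQ : (-Q).PosDef) (hobs : sys.IsEIObservable)
    (hxe : xe ∈ sys.assignableEquilibria)
    (hx : sys.IsTrajectoryOn (fun _ => sys.eqInput xe) x (Ici 0)) {L : ℝ}
    (hL : ∀ t, 0 ≤ t → bregman V xe (x t) = L) {t : ℝ} (ht : 0 ≤ t) : x t = xe := by
  refine hobs xe hxe x hx (fun s hs => ?_) t ht
  have hd := hx.hasDerivWithinAt_bregman hf hHM.differentiable xe hs
  have h0 := (uniqueDiffOn_Ici (0 : ℝ) s hs).eq_deriv _ hd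
    ((hasDerivWithinAt_const s (Ici 0) L).congr hL (hL s hs))
  have hh := eq_zero_of_dotProduct_mulVec_nonneg hQ
    (h0.symm.le.trans (hHM.inner_gradient_sub_rhs_le hG hxe (x s)))
  have : sys.h (x s) = sys.h xe := sub_eq_zero.1 (WithLp.ofLp_injective 2 hh)
  simp [eqOutput, output, this]

lemma isStableEquilibrium_eqInput (hf : Continuous sys.f) (hG : sys.G.rank = m)
    (hHM : sys.SatisfiesEIDHillMoylan Q S R V) (hV : StrictConvexOn ℝ univ V)
    (hQ : (-Q).PosDef) (hxe : xe ∈ sys.assignableEquilibria) :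
    sys.IsStableEquilibrium (sys.eqInput xe) xe := by
  refine ⟨rhs_eqInput hG hxe, fun ε hε => ?_⟩
  obtain ⟨c, hc, hcε⟩ := exists_pos_mul_norm_le_bregman hV hHM.differentiable xe hε
  have hcont := (continuous_bregman hHM.differentiable.continuous xe).tendsto xe
  rw [bregman_self] at hcont
  -- Starting with divergence below `c * ε` excludes distance `ε`, where it is at least `c * ε`.
  obtain ⟨δ, hδ, hδc⟩ := Metric.eventually_nhds_iff.1
    (hcont.eventually (gt_mem_nhds (mul_pos hc hε)))
  refine ⟨δ, hδ, fun x hx hx0 t ht => lt_of_not_ge fun hge => ?_⟩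
  have h1 := hx.antitoneOn_bregman hf hG hHM hQ hxe self_mem_Ici ht ht
  have h2 := hδc (y := x 0) (by rwa [dist_eq_norm])
  have h3 := hcε _ hge
  have h4 := mul_le_mul_of_nonneg_left hge hc.le
  simp only at h1
  linarith

/-- LaSalle's argument. Strict convexity alone makes the Lyapunov function coercive, so every
trajectory is bounded. -/
lemma IsTrajectoryOn.tendsto_equilibrium (hf : Continuous sys.f) (hG : sys.G.rank = m)
    (hHM : sys.SatisfiesEIDHillMoylan Q S R V) (hV : StrictConvexOn ℝ univ V)
    (hQ : (-Q).PosDef) (hobs : sys.IsEIObservable) (hxe : xe ∈ sys.assignableEquilibria)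
    (hx : sys.IsTrajectoryOn (fun _ => sys.eqInput xe) x (Ici 0)) :
    Tendsto x atTop (𝓝 xe) := by
  have hanti := hx.antitoneOn_bregman hf hG hHM hQ hxe
  obtain ⟨c, hc, hc1⟩ := exists_pos_mul_norm_le_bregman hV hHM.differentiable xe one_pos
  -- Beyond distance `1`, linear growth bounds the distance by the initial divergence over `c`.
  have hK : IsCompact (Metric.closedBall xe (max 1 (bregman V xe (x 0) / c))) :=
    isCompact_closedBall _ _
  have hxK : ∀ t, 0 ≤ t → x t ∈ Metric.closedBall xe (max 1 (bregman V xe (x 0) / c)) := by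
    intro t ht
    rw [mem_closedBall_iff_norm, le_max_iff]
    refine or_iff_not_imp_left.2 fun h => (le_div_iff₀' hc).2 ?_
    exact (hc1 _ (not_le.1 h).le).trans (hanti self_mem_Ici ht ht)
  have hL : ∃ L, Tendsto (fun t => bregman V xe (x t)) atTop (𝓝 L) := by
    have hm : Antitone fun t : ℝ => bregman V xe (x (max t 0)) := fun s t hst =>
      hanti (le_max_right s 0) (le_max_right t 0) (max_le_max_right 0 hst)
    have hb : BddBelow (range fun t : ℝ => bregman V xe (x (max t 0))) :=
      ⟨0, forall_mem_range.2 fun t => bregman_nonneg hV (hHM.differentiable xe) _⟩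
    refine ⟨_, (tendsto_atTop_ciInf hm hb).congr' ?_⟩
    filter_upwards [eventually_ge_atTop 0] with t ht
    rw [max_eq_left ht]
  obtain ⟨L, hL⟩ := hL
  refine hK.tendsto_nhds_of_unique_mapClusterPt
    ((eventually_ge_atTop 0).mono hxK) fun z _ hz => ?_
  obtain ⟨y, hyc, hy, rfl, hyL⟩ := exists_integralCurve_of_mapClusterPt
    (continuous_rhs hf (sys.eqInput xe)) hx.1 hx.2 hK hxK
    (continuous_bregman hHM.differentiable.continuous xe) hL hz
  exact IsTrajectoryOn.eq_of_bregman_const hf hG hHM hQ hobs hxe ⟨hyc.continuousOn, hy⟩ hyL le_rfl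

theorem isGloballyAsymptoticallyStable_eqInput (hsys : sys.IsAdmissible)
    (hHM : sys.SatisfiesEIDHillMoylan Q S R V) (hV : StrictConvexOn ℝ univ V)
    (hQ : (-Q).PosDef) (hobs : sys.IsEIObservable) (hxe : xe ∈ sys.assignableEquilibria) :
    sys.IsGloballyAsymptoticallyStable (sys.eqInput xe) xe where
  toIsStableEquilibrium :=
    isStableEquilibrium_eqInput hsys.continuous_f hsys.rank_G hHM hV hQ hxe
  attractive _ hx :=
    hx.tendsto_equilibrium hsys.continuous_f hsys.rank_G hHM hV hQ hobs hxe

lemma IsGloballyAsymptoticallyStable.isLocallyAsymptoticallyStable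
    {ue : EuclideanSpace ℝ (Fin m)} (h : sys.IsGloballyAsymptoticallyStable ue xe) :
    sys.IsLocallyAsymptoticallyStable ue xe where
  toIsStableEquilibrium := h.toIsStableEquilibrium
  attractive := ⟨1, one_pos, fun x hx _ => h.attractive x hx⟩

end ControlAffineSystem

theorem lemma3 {n m p : ℕ} (sys : ControlAffineSystem n m p) (hsys : sys.IsAdmissible)
    (Q : Matrix (Fin p) (Fin p) ℝ) (S : Matrix (Fin p) (Fin m) ℝ) (R : Matrix (Fin m) (Fin m) ℝ)
    (V : EuclideanSpace ℝ (Fin n) → ℝ)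
    (hHM : sys.SatisfiesEIDHillMoylan Q S R V)
    (hV : StrictConvexOn ℝ Set.univ V)
    (hQ : (-Q).PosDef)
    (hobs : sys.IsEIObservable) :
    (∀ xe ∈ sys.assignableEquilibria,
      sys.IsLocallyAsymptoticallyStable (sys.eqInput xe) xe) ∧
    ((∃ μ : ℝ, 0 < μ ∧ StrongConvexOn Set.univ μ V) →
      ∀ xe ∈ sys.assignableEquilibria,
        sys.IsGloballyAsymptoticallyStable (sys.eqInput xe) xe) := by
  have key := fun xe (hxe : xe ∈ sys.assignableEquilibria) =>
    ControlAffineSystem.isGloballyAsymptoticallyStable_eqInput hsys hHM hV hQ hobs hxe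
  exact ⟨fun xe hxe => (key xe hxe).isLocallyAsymptoticallyStable, fun _ => key⟩
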